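/- Let $G=(V_G,E_G)$ be a finite connected simple graph with at least one edge, $\lambda\colon E_G\to\mathbb{R}_{>0}$ an edge labeling, and $u,v\in V_G$ with $uv\notin E_G$. A realization $\rho\colon V_G\to\mathbb{R}^2$, $\rho(w)=(x_w,y_w)$, is compatible with $\lambda$ if $\|\rho(a)-\rho(b)\|=\lambda(ab)$ for all $ab\in E_G$; $\lambda$ is flexible if it has infinitely many compatible realizations up to direct Euclidean isometries of $\mathbb{R}^2$. For flexible $\lambda$, an algebraic motion of $(G,\lambda)$ is an irreducible real algebraic curve $\mathcal C\subseteq(\mathbb{R}^2)^{V_G}$, all of whose points are realizations compatible with $\lambda$, such that for some edge $\bar u\bar v\in E_G$ every $\rho\in\mathcal C$ satisfies $\rho(\bar u)=(0,0)$ and $\rho(\bar v)=(\lambda(\bar u\bar v),0)$. Let $F(\mathcal C)$ be its complex function field and $W_{a,b}=(x_b-x_a)+i(y_b-y_a)\in F(\mathcal C)$. A NAC-coloring of $G$ is a surjective map $\delta\colon E_G\to\{\text{red},\text{blue}\}$ such that no cycle of $G$ has exactly one red edge or exactly one blue edge. It is active with respect to $\mathcal C$ if there are a discrete valuation $\nu\colon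 F(\mathcal C)\to\mathbb{Z}\cup\{\infty\}$, trivial on $\mathbb{C}^{*}$, and $\alpha\in\mathbb{Q}$ such that for all $ab\in E_G$: $\delta(ab)=\text{red}\iff\nu(W_{a,b})>\alpha$. Let $\mathrm{NAC}_G$ denote the set of NAC-colorings of $G$ and $\mathrm{NAC}_G(\mathcal C)$ the set of active ones; the same definitions apply to $G'=(V_G,E_G\cup\{uv\})$, with the same function field and the same functions $W_{a,b}$. Let $\lambda$ be flexible and let $\mathcal C$ be an algebraic motion of $(G,\lambda)$ such that $\rho(u)\neq\rho(v)$ for all $\rho\in\mathcal C$. Suppose that there is a path $P$ from $u$ to $v$ in $G$ such that for every $\delta\in\mathrm{NAC}_G(\mathcal C)$ all edges of $P$ have the same color under $\delta$. Then there is a unique labeling $\lambda'\colon E_{G'}\to\mathbb{R}_{>0}$ with $\lambda'|_{E_G}=\lambda$ such that $\mathcal C$ is an algebraic motion of $(G',\lambda')$ (in particular $\lambda'$ is flexible), and $$\mathrm{NAC}_{G'}(\mathcal C)=\{\delta'\in\mathrm{NAC}_{G'} : \delta'|_{E_G}\in\mathrm{NAC}_G(\mathcal C)\}.$$ -/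

import Mathlib

noncomputable section

namespace AlgMotion

/-- The Euclidean plane. -/
abbrev Plane : Type := EuclideanSpace ℝ (Fin 2)

/-! ### Edge maps, colorings and NAC-colorings -/

/-- Restriction to `E_G` of a map defined on the edge set of a larger graph `H`. -/
def restrictEdges {V : Type*} {G H : SimpleGraph V} (h : G ≤ H) {α : Type*}
    (f : H.edgeSet → α) : G.edgeSet → α :=
  fun e => f (Set.inclusion (SimpleGraph.edgeSet_mono h) e)

/-- The graph `G + uv`, with the same vertices and the additional edge `uv`. -/
def addEdge {V : Type*} (G : SimpleGraph V) (u v : V) : SimpleGraph V :=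
  G ⊔ SimpleGraph.edge u v

theorem le_addEdge {V : Type*} (G : SimpleGraph V) (u v : V) : G ≤ addEdge G u v :=
  le_sup_left

/-- The two colors. -/
inductive Color : Type
  | red
  | blue

/-- A walk is unicolor if all its edges have the same color. -/
def IsUnicolor {V : Type*} {G : SimpleGraph V} (δ : G.edgeSet → Color) {u v : V}
    (p : G.Walk u v) : Prop :=
  ∃ c : Color, ∀ e : G.edgeSet, (e : Sym2 V) ∈ p.edges → δ e = c

/-- NAC-coloring: both colors are used, and no cycle has exactly one edge of some color. -/
def IsNAC {V : Type*} {G : SimpleGraph V} (δ : G.edgeSet → Color) : Prop :=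
  Function.Surjective δ ∧
    ∀ (w : V) (p : G.Walk w w), p.IsCycle →
      ∀ c : Color, ¬ ∃! e : G.edgeSet, (e : Sym2 V) ∈ p.edges ∧ δ e = c

/-! ### Labelings, realizations and flexibility -/

/-- An edge labeling with positive real numbers. -/
abbrev Labeling {V : Type*} (G : SimpleGraph V) : Type _ := G.edgeSet → {r : ℝ // 0 < r}

/-- The set of all realizations of `G` in the plane compatible with the labeling `lam`. -/
def realizations {V : Type*} (G : SimpleGraph V) (lam : Labeling G) : Set (V → Plane) :=
  {ρ | ∀ (u v : V) (h : G.Adj u v), ‖ρ u - ρ v‖ = (lam ⟨s(u, v), h⟩ : ℝ)}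

/-- Two maps to the plane are congruent if they differ by a direct Euclidean isometry. -/
def Congruent {V : Type*} (ρ₁ ρ₂ : V → Plane) : Prop :=
  ∃ σ : Plane ≃ᵃⁱ[ℝ] Plane,
    LinearMap.det (σ.linearIsometryEquiv.toLinearEquiv : Plane →ₗ[ℝ] Plane) = 1 ∧ ρ₁ = σ ∘ ρ₂

/-- The labeling is flexible: it has infinitely many congruence classes of compatible
realizations. -/
def IsFlexible {V : Type*} (G : SimpleGraph V) (lam : Labeling G) : Prop :=
  ((fun ρ : V → Plane => {ρ' : V → Plane | Congruent ρ' ρ}) '' realizations G lam).Infinite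

/-! ### Real algebraic sets and the complex function field -/

/-- The coordinates of a point of `(ℝ²)^V`: `(w, 0)` is the index of `x_w` and `(w, 1)` that
of `y_w`. -/
def coords {V : Type*} (ρ : V → Plane) : V × Fin 2 → ℝ := fun i => ρ i.1 i.2

/-- Real algebraic subsets of `(ℝ²)^V`. -/
def IsAlgebraicSet {V : Type*} (A : Set (V → Plane)) : Prop :=
  ∃ S : Set (MvPolynomial (V × Fin 2) ℝ),
    A = {ρ | ∀ f ∈ S, MvPolynomial.eval (coords ρ) f = 0}

/-- Irreducible real algebraic subsets of `(ℝ²)^V`. -/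
def IsIrreducibleAlgebraicSet {V : Type*} (A : Set (V → Plane)) : Prop :=
  IsAlgebraicSet A ∧ A.Nonempty ∧
    ∀ B₁ B₂ : Set (V → Plane), IsAlgebraicSet B₁ → IsAlgebraicSet B₂ →
      A = B₁ ∪ B₂ → A = B₁ ∨ A = B₂

/-- The ideal of all complex polynomials that vanish on a subset of `(ℝ²)^V`. -/
def complexIdeal {V : Type*} (A : Set (V → Plane)) : Ideal (MvPolynomial (V × Fin 2) ℂ) :=
  MvPolynomial.vanishingIdeal ℂ
    ((fun (ρ : V → Plane) (i : V × Fin 2) => ((coords ρ i : ℝ) : ℂ)) '' A)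

/-- The complex coordinate ring. -/
abbrev CoordRing {V : Type*} (A : Set (V → Plane)) : Type _ :=
  MvPolynomial (V × Fin 2) ℂ ⧸ complexIdeal A

/-- The complex function field: the field of fractions of the complex coordinate ring. For
irreducible `A` the coordinate ring is a domain (`f₁ f₂ = 0` on `A` gives
`|f₁|² |f₂|² = 0` on `A`, and `|f₁|²`, `|f₂|²` are real polynomials), so that this is a field. -/
abbrev FunctionField {V : Type*} (A : Set (V → Plane)) : Type _ :=
  FractionRing (CoordRing A)

/-- Irreducible real algebraic curves: the dimension, that is, the transcendence degree of the
function field, is one. -/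
def IsIrreducibleCurve {V : Type*} (A : Set (V → Plane)) : Prop :=
  IsIrreducibleAlgebraicSet A ∧ Algebra.trdeg ℂ (FunctionField A) = 1

/-! ### Algebraic motions and active NAC-colorings -/

/-- `C` is an algebraic motion of `(G, lam)` with respect to the edge from `a` to `b`. -/
def IsAlgebraicMotionWrt {V : Type*} (G : SimpleGraph V) (lam : Labeling G)
    (C : Set (V → Plane)) (a b : V) (hab : G.Adj a b) : Prop :=
  IsFlexible G lam ∧ IsIrreducibleCurve C ∧ C ⊆ realizations G lam ∧
    ∀ ρ ∈ C, ρ a = 0 ∧ ρ b = !₂[(lam ⟨s(a, b), hab⟩ : ℝ), 0]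

/-- `C` is an algebraic motion of `(G, lam)` (with respect to some edge). -/
def IsAlgebraicMotion {V : Type*} (G : SimpleGraph V) (lam : Labeling G)
    (C : Set (V → Plane)) : Prop :=
  ∃ (a b : V) (hab : G.Adj a b), IsAlgebraicMotionWrt G lam C a b hab

/-- The function `W_{u,v} = (x_v - x_u) + i (y_v - y_u)` in the function field. -/
def W {V : Type*} (C : Set (V → Plane)) (u v : V) : FunctionField C :=
  algebraMap (CoordRing C) (FunctionField C)
    (Ideal.Quotient.mk (complexIdeal C)
      ((MvPolynomial.X (v, 0) - MvPolynomial.X (u, 0)) +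
        MvPolynomial.C Complex.I * (MvPolynomial.X (v, 1) - MvPolynomial.X (u, 1))))

/-- `ν`, an integer-valued valuation of the function field (with `ν 0 = ∞`), is trivial on the
nonzero constants. -/
def IsTrivialOnConstants {V : Type*} (C : Set (V → Plane))
    (ν : AddValuation (FunctionField C) (WithTop ℤ)) : Prop :=
  ∀ z : ℂ, z ≠ 0 → ν (algebraMap ℂ (FunctionField C) z) = 0

/-- The active NAC-colorings of `G` with respect to `C`: those given by a valuation `ν` of the
function field of `C` and a threshold `α ∈ ℚ` through `δ(uv) = red ↔ ν(W_{u,v}) > α`. -/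
def activeNAC {V : Type*} (G : SimpleGraph V) (C : Set (V → Plane)) :
    Set (G.edgeSet → Color) :=
  {δ | IsNAC δ ∧
    ∃ (ν : AddValuation (FunctionField C) (WithTop ℤ)) (α : ℚ), IsTrivialOnConstants C ν ∧
      ∀ (u v : V) (h : G.Adj u v),
        δ ⟨s(u, v), h⟩ = Color.red ↔
          (α : WithTop ℚ) < (ν (W C u v)).map (fun n : ℤ => (n : ℚ))}

end AlgMotion

end

open Classical in
/-- The additive form of an integer-valued valuation of a field. -/
noncomputable def Valuation.toAddValuationInt {F : Type*} [Field F]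
    (v : Valuation F (WithZero (Multiplicative ℤ))) : AddValuation F (WithTop ℤ) :=
  AddValuation.of (fun x => if x = 0 then ⊤ else ((-WithZero.log (v x) : ℤ) : WithTop ℤ))
    (by simp) (by simp)
    (by
      intro x y
      by_cases hx : x = 0
      · simp [hx]
      by_cases hy : y = 0
      · simp [hy]
      by_cases hxy : x + y = 0
      · simp [hxy]
      have h0 : v (x + y) ≠ 0 := by simpa using hxy
      simp only [hx, hy, hxy, if_false]
      rw [min_le_iff, WithTop.coe_le_coe, WithTop.coe_le_coe]
      rcases v.map_add' x y with h | h
      · left; exact neg_le_neg ((WithZero.log_le_log h0 (by simpa using hx)).2 h)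
      · right; exact neg_le_neg ((WithZero.log_le_log h0 (by simpa using hy)).2 h))
    (by
      intro x y
      by_cases hx : x = 0
      · simp [hx]
      by_cases hy : y = 0
      · simp [hy]
      have hx' : v x ≠ 0 := by simpa using hx
      have hy' : v y ≠ 0 := by simpa using hy
      simp only [hx, hy, mul_eq_zero, or_self, if_false, map_mul]
      rw [WithZero.log_mul hx' hy', ← WithTop.coe_add, neg_add])

theorem Valuation.toAddValuationInt_apply {F : Type*} [Field F]
    (v : Valuation F (WithZero (Multiplicative ℤ))) {x : F} (hx : x ≠ 0) :
    v.toAddValuationInt x = ((-WithZero.log (v x) : ℤ) : WithTop ℤ) := by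
  simp [Valuation.toAddValuationInt, hx]

open Polynomial in
theorem exists_valuation_lt_one {k F : Type*} [Field k] [CharZero k] [Field F] [Algebra k F]
    [Algebra.EssFiniteType k F] (htr : Algebra.trdeg k F = 1) {t : F} (ht : Transcendental k t) :
    ∃ v : Valuation F (WithZero (Multiplicative ℤ)),
      (∀ z : k, z ≠ 0 → v (algebraMap k F z) = 1) ∧ v t < 1 := by
  have hinj : Function.Injective (aeval t : k[X] →ₐ[k] F) := transcendental_iff_injective.1 ht
  let _ : Algebra k[X] F := (aeval t : k[X] →ₐ[k] F).toRingHom.toAlgebra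
  have hmap : ∀ p : k[X], algebraMap k[X] F p = aeval t p := fun _ => rfl
  have : IsScalarTower k k[X] F := IsScalarTower.of_algebraMap_eq fun z => by
    rw [hmap, algebraMap_eq, aeval_C]
  have : FaithfulSMul k[X] F := (faithfulSMul_iff_algebraMap_injective _ _).2 hinj
  let K := FractionRing k[X]
  let _ : Algebra K F := FractionRing.liftAlgebra k[X] F
  have : IsScalarTower k[X] K F := inferInstance
  have : IsScalarTower k K F := IsScalarTower.of_algebraMap_eq fun z => by
    rw [IsScalarTower.algebraMap_apply k k[X] F, IsScalarTower.algebraMap_apply k[X] K F,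
      ← IsScalarTower.algebraMap_apply k k[X] K]
  have : Algebra.EssFiniteType K F := Algebra.EssFiniteType.of_comp k K F
  have : Algebra.IsAlgebraic k[X] F := by
    have h := lift_trdeg_add_eq k k[X] F
    rw [htr, Polynomial.trdeg_of_isDomain, Cardinal.lift_one, Cardinal.lift_one] at h
    have h0 : Algebra.trdeg k[X] F = 0 := by
      simpa using Cardinal.eq_of_add_eq_add_left (h.trans (add_zero 1).symm) Cardinal.one_lt_aleph0
    exact trdeg_eq_zero_iff.1 h0
  have : Algebra.IsAlgebraic K F :=
    (IsFractionRing.comap_isAlgebraic_iff (A := k[X]) (K := K) (C := F)).1 inferInstance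
  have : FiniteDimensional K F := Algebra.finite_of_essFiniteType_of_isAlgebraic
  let B := integralClosure k[X] F
  have : IsDedekindDomain B := integralClosure.isDedekindDomain k[X] K F
  have : IsFractionRing B F := integralClosure.isFractionRing_of_finite_extension K F
  have : FaithfulSMul k[X] B := by
    rw [faithfulSMul_iff_algebraMap_injective]
    exact fun a b h => hinj (congrArg (algebraMap B F) h)
  have : (Ideal.span {(X : k[X])}).IsMaximal :=
    PrincipalIdealRing.isMaximal_of_irreducible irreducible_X
  obtain ⟨P, hP, hPX⟩ := Ideal.exists_maximal_ideal_liesOver_of_isIntegral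
    (S := B) (Ideal.span {(X : k[X])})
  have hmem : algebraMap k[X] B X ∈ P := by
    rw [← Ideal.mem_of_liesOver P (Ideal.span {(X : k[X])})]
    exact Ideal.mem_span_singleton_self X
  have hne : P ≠ ⊥ := by
    rintro rfl
    rw [Ideal.mem_bot, FaithfulSMul.algebraMap_eq_zero_iff] at hmem
    exact X_ne_zero hmem
  let w : IsDedekindDomain.HeightOneSpectrum B := ⟨P, hP.isPrime, hne⟩
  refine ⟨w.valuation F, fun z hz => ?_, ?_⟩
  · have h1 : ∀ z : k, w.valuation F (algebraMap k F z) ≤ 1 := fun z => by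
      rw [IsScalarTower.algebraMap_apply k k[X] F, IsScalarTower.algebraMap_apply k[X] B F]
      exact w.valuation_le_one _
    refine le_antisymm (h1 z) ?_
    have h2 := h1 z⁻¹
    rw [map_inv₀, map_inv₀] at h2
    exact (inv_le_one₀ (zero_lt_iff.2 (by simpa using hz))).1 h2
  · have h := (w.valuation_lt_one_iff_mem (K := F) (algebraMap k[X] B X)).2 hmem
    have h' : w.valuation F (algebraMap k[X] F X) < 1 := h
    rwa [hmap, aeval_X] at h'

theorem exists_addValuation_neg {k F : Type*} [Field k] [CharZero k] [Field F] [Algebra k F]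
    [Algebra.EssFiniteType k F] (htr : Algebra.trdeg k F = 1) {l : F} (hl : Transcendental k l) :
    ∃ ν : AddValuation F (WithTop ℤ),
      (∀ z : k, z ≠ 0 → ν (algebraMap k F z) = 0) ∧ ν l < 0 := by
  have hl0 : l ≠ 0 := by rintro rfl; exact hl isAlgebraic_zero
  have hinv : Transcendental k l⁻¹ := fun h => hl (by simpa using h.inv)
  obtain ⟨v, hv, hvl⟩ := exists_valuation_lt_one htr hinv
  refine ⟨v.toAddValuationInt, fun z hz => ?_, ?_⟩
  · rw [v.toAddValuationInt_apply (by simpa using hz), hv z hz]; simp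
  · rw [v.toAddValuationInt_apply hl0]
    rw [map_inv₀] at hvl
    have h1 : 1 < v l := by
      by_contra! h
      exact absurd hvl (not_lt.2 ((one_le_inv₀ (zero_lt_iff.2 (by simpa using hl0))).2 h))
    have h2 := (WithZero.log_lt_log one_ne_zero (by simpa using hl0)).2 h1
    rw [WithZero.log_one] at h2
    exact_mod_cast neg_lt_zero.2 h2

namespace AlgMotion

section Combinatorics

variable {V : Type*} {G : SimpleGraph V}

theorem rel_of_walk {R : V → V → Prop} (hR : Equivalence R) {x y : V} (p : G.Walk x y)
    (h : ∀ a b, s(a, b) ∈ p.edges → R a b) : R x y := by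
  induction p with
  | nil => exact hR.refl _
  | cons hadj p ih =>
    exact hR.trans (h _ _ (by simp)) (ih fun a b hab => h a b (by simp [hab]))

theorem rel_of_walk_of_mem_edges {R : V → V → Prop} (hR : Equivalence R) {a b x y : V}
    (p : G.Walk x y) (hp : p.edges.Nodup) (hmem : s(a, b) ∈ p.edges)
    (h : ∀ c d, s(c, d) ∈ p.edges → s(c, d) ≠ s(a, b) → R c d) :
    (R x a ∧ R b y) ∨ (R x b ∧ R a y) := by
  induction p with
  | nil => simp at hmem
  | @cons x z y hadj p ih =>
    rw [SimpleGraph.Walk.edges_cons, List.nodup_cons] at hp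
    by_cases he : s(a, b) = s(x, z)
    · have hzy : R z y := rel_of_walk hR p fun c d hcd =>
        h c d (by simp [hcd]) (by rintro h'; rw [h', he] at hcd; exact hp.1 hcd)
      rcases Sym2.eq_iff.1 he with ⟨rfl, rfl⟩ | ⟨rfl, rfl⟩
      · exact Or.inl ⟨hR.refl _, hzy⟩
      · exact Or.inr ⟨hR.refl _, hzy⟩
    · have hxz : R x z := h x z (by simp) (Ne.symm he)
      have hmem' : s(a, b) ∈ p.edges := by
        rw [SimpleGraph.Walk.edges_cons, List.mem_cons] at hmem
        exact hmem.resolve_left he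
      rcases ih hp.2 hmem' fun c d hcd => h c d (by simp [hcd]) with ⟨h1, h2⟩ | ⟨h1, h2⟩
      · exact Or.inl ⟨hR.trans hxz h1, h2⟩
      · exact Or.inr ⟨hR.trans hxz h1, h2⟩

theorem rel_of_closed_walk {R : V → V → Prop} (hR : Equivalence R) {a b x : V}
    (p : G.Walk x x) (hp : p.edges.Nodup) (hmem : s(a, b) ∈ p.edges)
    (h : ∀ c d, s(c, d) ∈ p.edges → s(c, d) ≠ s(a, b) → R c d) : R a b := by
  rcases rel_of_walk_of_mem_edges hR p hp hmem h with ⟨h1, h2⟩ | ⟨h1, h2⟩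
  · exact hR.symm (hR.trans h2 h1)
  · exact hR.trans h2 h1

theorem Color.eq_of_ne_of_ne {c c₁ c₂ : Color} (h₁ : c₁ ≠ c) (h₂ : c₂ ≠ c) : c₁ = c₂ := by
  cases c <;> cases c₁ <;> cases c₂ <;> simp_all

/-- A surjective coloring is a NAC-coloring as soon as, for each color `c`, the edges of color `c`
are contained in an equivalence relation that contains no edge of the other color. -/
theorem isNAC_of_equivalence {δ : G.edgeSet → Color} (hδ : Function.Surjective δ)
    (R : Color → V → V → Prop) (hR : ∀ c, Equivalence (R c))
    (h : ∀ (a b : V) (hab : G.Adj a b) (c : Color), δ ⟨s(a, b), hab⟩ = c ↔ R c a b) :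
    IsNAC δ := by
  refine ⟨hδ, fun w p hp c => ?_⟩
  rintro ⟨⟨e, he⟩, ⟨hep, hec⟩, huniq⟩
  induction e with | _ a b
  obtain ⟨c', hc'⟩ : ∃ c' : Color, c' ≠ c := by
    cases c
    · exact ⟨Color.blue, by simp⟩
    · exact ⟨Color.red, by simp⟩
  have hab : R c' a b := rel_of_closed_walk (hR c') p hp.isTrail.edges_nodup hep fun x y hxy hne => by
    have hadj : G.Adj x y := p.adj_of_mem_edges hxy
    rw [← h x y hadj]
    refine Color.eq_of_ne_of_ne (c := c) (fun hc => hne ?_) hc'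
    exact congrArg Subtype.val (huniq ⟨s(x, y), hadj⟩ ⟨hxy, hc⟩)
  exact hc' (((h a b he c').2 hab).symm.trans hec)

variable {u v : V}

theorem addEdge_adj (huv : u ≠ v) : (addEdge G u v).Adj u v := by
  simp [addEdge, SimpleGraph.edge_adj, huv]

theorem addEdge_adj_iff {a b : V} :
    (addEdge G u v).Adj a b ↔ G.Adj a b ∨ (s(a, b) = s(u, v) ∧ u ≠ v) := by
  rw [addEdge, SimpleGraph.sup_adj, SimpleGraph.edge_adj]
  refine or_congr_right ?_
  rw [Sym2.eq_iff]
  constructor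
  · rintro ⟨h | h, hne⟩ <;> obtain ⟨rfl, rfl⟩ := h
    · exact ⟨Or.inl ⟨rfl, rfl⟩, hne⟩
    · exact ⟨Or.inr ⟨rfl, rfl⟩, hne.symm⟩
  · rintro ⟨h | h, hne⟩ <;> obtain ⟨rfl, rfl⟩ := h
    · exact ⟨Or.inl ⟨rfl, rfl⟩, hne⟩
    · exact ⟨Or.inr ⟨rfl, rfl⟩, hne.symm⟩

theorem IsNAC.color_addEdge_eq {δ : (addEdge G u v).edgeSet → Color} (hδ : IsNAC δ)
    (huv : u ≠ v) (hadj : ¬ G.Adj u v) {P : G.Walk u v} (hP : P.IsPath) {c : Color}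
    (hc : ∀ e : G.edgeSet, (e : Sym2 V) ∈ P.edges → restrictEdges (le_addEdge G u v) δ e = c) :
    δ ⟨s(u, v), addEdge_adj huv⟩ = c := by
  by_contra hne
  have hnot : s(u, v) ∉ P.edges := fun h => hadj (P.adj_of_mem_edges h)
  let p := SimpleGraph.Walk.cons (addEdge_adj (G := G) huv).symm (P.mapLe (le_addEdge G u v))
  have hp : p.IsCycle := by
    rw [SimpleGraph.Walk.cons_isCycle_iff, SimpleGraph.Walk.isPath_mapLe,
      SimpleGraph.Walk.edges_mapLe_eq_edges, Sym2.eq_swap]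
    exact ⟨hP, hnot⟩
  refine hδ.2 v p hp _ ⟨⟨s(u, v), addEdge_adj huv⟩, ⟨?_, rfl⟩, ?_⟩
  · simp [p, Sym2.eq_swap]
  · rintro ⟨e, he⟩ ⟨hep, hec⟩
    simp only [p, SimpleGraph.Walk.edges_cons, SimpleGraph.Walk.edges_mapLe_eq_edges,
      List.mem_cons] at hep
    rcases hep with rfl | hep
    · exact Subtype.ext Sym2.eq_swap
    · exact absurd (hec.symm.trans (hc ⟨e, P.edges_subset_edgeSet hep⟩ hep)) hne

theorem IsNAC.restrictEdges {δ : (addEdge G u v).edgeSet → Color} (hδ : IsNAC δ)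
    (huv : u ≠ v) (hadj : ¬ G.Adj u v) {P : G.Walk u v} (hP : P.IsPath) :
    IsNAC (restrictEdges (le_addEdge G u v) δ) := by
  constructor
  · intro c
    by_contra! hc
    obtain ⟨⟨e, he⟩, hec⟩ := hδ.1 c
    have hall : ∀ e : G.edgeSet, AlgMotion.restrictEdges (le_addEdge G u v) δ e ≠ c := hc
    obtain ⟨c', hc'⟩ : ∃ c' : Color, c' ≠ c := by
      cases c
      · exact ⟨Color.blue, by simp⟩
      · exact ⟨Color.red, by simp⟩
    have huvc := hδ.color_addEdge_eq huv hadj hP fun e _ => Color.eq_of_ne_of_ne (hall e) hc'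
    induction e with | _ a b
    rcases addEdge_adj_iff.1 he with h | ⟨h, -⟩
    · exact hall ⟨s(a, b), h⟩ hec
    · refine hc' (huvc.symm.trans (Eq.trans ?_ hec))
      exact congrArg δ (Subtype.ext h.symm)
  · rintro w p hp c ⟨⟨e, he⟩, ⟨hep, hec⟩, huniq⟩
    refine hδ.2 w (p.mapLe (le_addEdge G u v)) ((SimpleGraph.Walk.isCycle_mapLe _).2 hp) c
      ⟨Set.inclusion (SimpleGraph.edgeSet_mono (le_addEdge G u v)) ⟨e, he⟩, ⟨?_, hec⟩, ?_⟩
    · simpa using hep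
    · rintro ⟨f, hf⟩ ⟨hfp, hfc⟩
      rw [SimpleGraph.Walk.edges_mapLe_eq_edges] at hfp
      have hfe : f = e :=
        congrArg Subtype.val (huniq ⟨f, p.edges_subset_edgeSet hfp⟩ ⟨hfp, hfc⟩)
      exact Subtype.ext hfe

end Combinatorics

end AlgMotion

noncomputable section
namespace AlgMotion

section CoordinateRing

theorem exists_re_im_polynomial {σ : Type*} (p : MvPolynomial σ ℂ) :
    ∃ g h : MvPolynomial σ ℝ, ∀ x : σ → ℝ,
      MvPolynomial.aeval (fun i => (x i : ℂ)) p =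
        (MvPolynomial.eval x g : ℂ) + (MvPolynomial.eval x h : ℂ) * Complex.I := by
  induction p using MvPolynomial.induction_on with
  | C a =>
    refine ⟨MvPolynomial.C a.re, MvPolynomial.C a.im, fun x => ?_⟩
    simp [Complex.re_add_im]
  | add p q hp hq =>
    obtain ⟨g₁, h₁, h1⟩ := hp
    obtain ⟨g₂, h₂, h2⟩ := hq
    refine ⟨g₁ + g₂, h₁ + h₂, fun x => ?_⟩
    rw [map_add, h1, h2]
    push_cast [map_add]
    ring
  | mul_X p i hp =>
    obtain ⟨g, h, h1⟩ := hp
    refine ⟨g * MvPolynomial.X i, h * MvPolynomial.X i, fun x => ?_⟩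
    rw [map_mul, h1]
    simp
    ring

variable {V : Type*} {A : Set (V → Plane)}

theorem mem_complexIdeal {p : MvPolynomial (V × Fin 2) ℂ} :
    p ∈ complexIdeal A ↔
      ∀ ρ ∈ A, MvPolynomial.aeval (fun i => ((coords ρ i : ℝ) : ℂ)) p = 0 := by
  rw [complexIdeal, MvPolynomial.mem_vanishingIdeal_iff, Set.forall_mem_image]

theorem IsAlgebraicSet.inter_zeros (hA : IsAlgebraicSet A) (p : MvPolynomial (V × Fin 2) ℂ) :
    IsAlgebraicSet
      {ρ ∈ A | MvPolynomial.aeval (fun i => ((coords ρ i : ℝ) : ℂ)) p = 0} := by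
  obtain ⟨S, rfl⟩ := hA
  obtain ⟨g, h, hgh⟩ := exists_re_im_polynomial p
  refine ⟨insert g (insert h S), ?_⟩
  ext ρ
  have : (MvPolynomial.eval (coords ρ) g : ℂ) + (MvPolynomial.eval (coords ρ) h : ℂ) * Complex.I
      = 0 ↔ MvPolynomial.eval (coords ρ) g = 0 ∧ MvPolynomial.eval (coords ρ) h = 0 := by
    simp [Complex.ext_iff]
  simp only [Set.mem_ofPred_eq, Set.forall_mem_insert, hgh, this]
  tauto

theorem IsIrreducibleAlgebraicSet.isPrime_complexIdeal (hA : IsIrreducibleAlgebraicSet A) :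
    (complexIdeal A).IsPrime := by
  obtain ⟨halg, ⟨ρ₀, hρ₀⟩, hirr⟩ := hA
  constructor
  · intro h
    have := mem_complexIdeal.1 ((Ideal.eq_top_iff_one _).1 h) ρ₀ hρ₀
    simp at this
  · intro p q hpq
    have hunion := hirr _ _ (halg.inter_zeros p) (halg.inter_zeros q) (by
      ext ρ
      have := mem_complexIdeal.1 hpq ρ
      rw [map_mul, mul_eq_zero] at this
      simp only [Set.mem_union, Set.mem_ofPred_eq]
      tauto)
    refine hunion.imp (fun h => ?_) fun h => ?_ <;>
    · rw [mem_complexIdeal]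
      intro ρ hρ
      rw [h] at hρ
      exact hρ.2

theorem essFiniteType_functionField [Finite V] :
    Algebra.EssFiniteType ℂ (FunctionField A) := by
  have : Algebra.EssFiniteType (CoordRing A) (FunctionField A) :=
    Algebra.EssFiniteType.of_isLocalization _ (nonZeroDivisors (CoordRing A))
  exact Algebra.EssFiniteType.comp ℂ (CoordRing A) (FunctionField A)

theorem IsIrreducibleCurve.infinite (hA : IsIrreducibleCurve A) : A.Infinite := by
  intro hfin
  have := hfin.to_subtype
  have hprime := hA.1.isPrime_complexIdeal
  have : IsDomain (CoordRing A) := inferInstance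
  let φ : MvPolynomial (V × Fin 2) ℂ →ₐ[ℂ] (A → ℂ) :=
    AlgHom.pi fun ρ => MvPolynomial.aeval fun i => ((coords ρ.1 i : ℝ) : ℂ)
  have hφ : ∀ p ∈ complexIdeal A, φ p = 0 := fun p hp => by
    ext ρ
    exact mem_complexIdeal.1 hp ρ.1 ρ.2
  let ψ : CoordRing A →ₐ[ℂ] (A → ℂ) := Ideal.Quotient.liftₐ (complexIdeal A) φ hφ
  have hψ : Function.Injective ψ := by
    rw [injective_iff_map_eq_zero]
    intro x hx
    obtain ⟨p, rfl⟩ := Ideal.Quotient.mk_surjective x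
    rw [Ideal.Quotient.eq_zero_iff_mem, mem_complexIdeal]
    intro ρ hρ
    exact congrFun hx ⟨ρ, hρ⟩
  have : Module.Finite ℂ (CoordRing A) := Module.Finite.of_injective ψ.toLinearMap hψ
  have : Algebra.IsAlgebraic (CoordRing A) (FunctionField A) :=
    IsLocalization.isAlgebraic _ (nonZeroDivisors (CoordRing A))
  have : Algebra.IsAlgebraic ℂ (FunctionField A) :=
    Algebra.IsAlgebraic.trans ℂ (CoordRing A) (FunctionField A)
  have h0 := trdeg_eq_zero_iff.2 this
  rw [hA.2] at h0
  exact one_ne_zero h0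

end CoordinateRing

section Congruence

theorem eq_refl_of_fixed_of_det {L : Plane ≃ₗᵢ[ℝ] Plane}
    (hdet : LinearMap.det (L.toLinearEquiv : Plane →ₗ[ℝ] Plane) = 1) {r : ℝ} (hr : r ≠ 0)
    (hfix : L !₂[r, 0] = !₂[r, 0]) (x : Plane) : L x = x := by
  let B := (EuclideanSpace.basisFun (Fin 2) ℝ).toBasis
  have hB : ∀ i, B i = EuclideanSpace.single i 1 := fun i => by simp [B]
  have h0 : L (EuclideanSpace.single 0 1) = EuclideanSpace.single 0 1 := by
    have he : (EuclideanSpace.single 0 1 : Plane) = r⁻¹ • !₂[r, 0] := by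
      ext i; fin_cases i <;> simp [hr]
    rw [he, map_smul, hfix]
  have hd : L (EuclideanSpace.single 1 1) 1 = 1 := by
    rw [← LinearMap.det_toMatrix B, Matrix.det_fin_two] at hdet
    simpa [LinearMap.toMatrix_apply, hB, h0, B] using hdet
  have hc : L (EuclideanSpace.single 1 1) 0 = 0 := by
    have hn : ‖L (EuclideanSpace.single 1 1)‖ ^ 2 = 1 := by rw [L.norm_map]; simp
    rw [EuclideanSpace.real_norm_sq_eq, Fin.sum_univ_two, hd] at hn
    nlinarith
  have h1 : L (EuclideanSpace.single 1 1) = EuclideanSpace.single 1 1 := by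
    ext i; fin_cases i <;> simp [hc, hd]
  have : (L.toLinearEquiv : Plane →ₗ[ℝ] Plane) = LinearMap.id := B.ext fun i => by
    rw [hB]
    fin_cases i
    · exact h0
    · exact h1
  exact LinearMap.congr_fun this x

variable {V : Type*}

theorem Congruent.refl (ρ : V → Plane) : Congruent ρ ρ :=
  ⟨AffineIsometryEquiv.refl ℝ Plane, by
    have : ((AffineIsometryEquiv.refl ℝ Plane).linearIsometryEquiv.toLinearEquiv :
        Plane →ₗ[ℝ] Plane) = LinearMap.id := rfl
    rw [this, LinearMap.det_id], rfl⟩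

theorem Congruent.eq_of_fixed {ρ₁ ρ₂ : V → Plane} (h : Congruent ρ₁ ρ₂) {a b : V} {r : ℝ}
    (hr : r ≠ 0) (h₁ : ρ₁ a = 0 ∧ ρ₁ b = !₂[r, 0]) (h₂ : ρ₂ a = 0 ∧ ρ₂ b = !₂[r, 0]) :
    ρ₁ = ρ₂ := by
  obtain ⟨σ, hdet, rfl⟩ := h
  have h0 : σ 0 = 0 := by simpa [h₂.1] using h₁.1
  have hσ : ∀ x, σ x = σ.linearIsometryEquiv x := fun x => by
    have := σ.map_vadd 0 x
    simpa [h0] using this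
  have hfix : σ.linearIsometryEquiv !₂[r, 0] = !₂[r, 0] := by
    rw [← hσ]; simpa [h₂.2] using h₁.2
  funext w
  rw [Function.comp_apply, hσ, eq_refl_of_fixed_of_det hdet hr hfix]

theorem isFlexible_of_infinite {G : SimpleGraph V} {lam : Labeling G} {C : Set (V → Plane)}
    (hinf : C.Infinite) (hC : C ⊆ realizations G lam) {a b : V} {r : ℝ} (hr : r ≠ 0)
    (hfix : ∀ ρ ∈ C, ρ a = 0 ∧ ρ b = !₂[r, 0]) : IsFlexible G lam := by
  refine (hinf.image fun ρ₁ h₁ ρ₂ h₂ h => ?_).mono (Set.image_mono hC)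
  have hmem : ρ₁ ∈ {ρ' | Congruent ρ' ρ₂} := by
    rw [← show {ρ' | Congruent ρ' ρ₁} = {ρ' | Congruent ρ' ρ₂} from h]
    exact Congruent.refl ρ₁
  exact Congruent.eq_of_fixed hmem hr (hfix ρ₁ h₁) (hfix ρ₂ h₂)

end Congruence

end AlgMotion
end

noncomputable section
namespace AlgMotion

section DistanceFunctions

variable {V : Type*} {C : Set (V → Plane)}

/-- The function `Z_{u,v} = (x_v - x_u) - i (y_v - y_u)` in the function field. -/
def Z (C : Set (V → Plane)) (u v : V) : FunctionField C :=
  algebraMap (CoordRing C) (FunctionField C)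
    (Ideal.Quotient.mk (complexIdeal C)
      ((MvPolynomial.X (v, 0) - MvPolynomial.X (u, 0)) -
        MvPolynomial.C Complex.I * (MvPolynomial.X (v, 1) - MvPolynomial.X (u, 1))))

theorem W_add_W (a b c : V) : W C a b + W C b c = W C a c := by
  simp only [W, ← map_add]
  congr 2
  ring

theorem Z_add_Z (a b c : V) : Z C a b + Z C b c = Z C a c := by
  simp only [Z, ← map_add]
  congr 2
  ring

theorem W_mul_Z_eq_iff {a b : V} {c : ℂ} :
    W C a b * Z C a b = algebraMap ℂ (FunctionField C) c ↔
      ∀ ρ ∈ C, ((‖ρ a - ρ b‖ ^ 2 : ℝ) : ℂ) = c := by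
  rw [IsScalarTower.algebraMap_apply ℂ (CoordRing C) (FunctionField C),
    ← Ideal.Quotient.mk_algebraMap, W, Z, ← map_mul, ← map_mul,
    (IsFractionRing.injective (CoordRing C) (FunctionField C)).eq_iff, Ideal.Quotient.eq,
    mem_complexIdeal]
  refine forall₂_congr fun ρ _ => ?_
  rw [← sub_eq_zero (b := c), EuclideanSpace.real_norm_sq_eq, Fin.sum_univ_two]
  refine Eq.congr_left ?_
  simp only [MvPolynomial.algebraMap_eq, map_sub, map_mul, map_add, MvPolynomial.aeval_X,
    MvPolynomial.aeval_C, coords, Algebra.algebraMap_self, RingHom.id_apply, PiLp.sub_apply]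
  push_cast
  linear_combination (-((ρ b 1 : ℂ) - ρ a 1) ^ 2) * Complex.I_sq

theorem W_mul_Z_of_adj {G : SimpleGraph V} {lam : Labeling G} (hC : C ⊆ realizations G lam)
    {a b : V} (hab : G.Adj a b) :
    ∃ c : ℂ, c ≠ 0 ∧ W C a b * Z C a b = algebraMap ℂ (FunctionField C) c := by
  refine ⟨(((lam ⟨s(a, b), hab⟩ : ℝ) ^ 2 : ℝ) : ℂ), ?_, W_mul_Z_eq_iff.2 fun ρ hρ => ?_⟩
  · exact_mod_cast pow_ne_zero 2 (lam ⟨s(a, b), hab⟩).2.ne'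
  · rw [hC hρ a b hab]

end DistanceFunctions

section Thresholds

theorem equivalence_of_threshold {V F : Type*} [CommRing F] (ν : AddValuation F (WithTop ℤ))
    {f : V → V → F} (hf : ∀ a b c, f a b + f b c = f a c) {p : WithTop ℤ → Prop} (htop : p ⊤)
    (hp : ∀ x y, p x → x ≤ y → p y) : Equivalence fun a b => p (ν (f a b)) := by
  have h0 : ∀ a, f a a = 0 := fun a => by simpa using hf a a a
  refine ⟨fun a => by simpa [h0] using htop, fun {a b} h => ?_, fun {a b c} h₁ h₂ => ?_⟩
  · have hba : f b a = -f a b := by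
      rw [eq_neg_iff_add_eq_zero, hf, h0]
    rwa [hba, ν.map_neg]
  · rw [← hf a b c]
    rcases ν.map_add' (f a b) (f b c) with h | h
    · exact hp _ _ h₁ h
    · exact hp _ _ h₂ h

variable {V : Type*} {G : SimpleGraph V} {C : Set (V → Plane)}

/-- The equivalence relations on the vertices cut out by a valuation and an integer threshold. -/
def ThresholdRel (ν : AddValuation (FunctionField C) (WithTop ℤ)) (n : ℤ) : Color → V → V → Prop
  | Color.red => fun a b => (n : WithTop ℤ) < ν (W C a b)
  | Color.blue => fun a b => ((-n : ℤ) : WithTop ℤ) ≤ ν (Z C a b)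

theorem equivalence_thresholdRel (ν : AddValuation (FunctionField C) (WithTop ℤ)) (n : ℤ)
    (c : Color) : Equivalence (ThresholdRel ν n c) := by
  cases c
  · exact equivalence_of_threshold ν W_add_W (p := fun x => (n : WithTop ℤ) < x)
      (WithTop.coe_lt_top n) fun _ _ h h' => h.trans_le h'
  · exact equivalence_of_threshold ν Z_add_Z (p := fun x => ((-n : ℤ) : WithTop ℤ) ≤ x)
      le_top fun _ _ h h' => h.trans h'

theorem IsTrivialOnConstants.exists_map_W {ν : AddValuation (FunctionField C) (WithTop ℤ)}
    (hν : IsTrivialOnConstants C ν) {a b : V}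
    (h : ∃ c : ℂ, c ≠ 0 ∧ W C a b * Z C a b = algebraMap ℂ (FunctionField C) c) :
    ∃ m : ℤ, ν (W C a b) = m ∧ ν (Z C a b) = ((-m : ℤ) : WithTop ℤ) := by
  obtain ⟨c, hc, h⟩ := h
  have h1 := congrArg ν h
  rw [ν.map_mul, hν c hc] at h1
  generalize ν (W C a b) = x at h1
  generalize ν (Z C a b) = y at h1
  induction x with
  | top => simp at h1
  | coe x =>
    induction y with
    | top => simp at h1
    | coe y =>
      refine ⟨x, rfl, ?_⟩
      have h2 : x + y = 0 := by exact_mod_cast h1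
      rw [WithTop.coe_inj]
      omega

theorem IsTrivialOnConstants.thresholdRel_iff {ν : AddValuation (FunctionField C) (WithTop ℤ)}
    (hν : IsTrivialOnConstants C ν) {a b : V}
    (h : ∃ c : ℂ, c ≠ 0 ∧ W C a b * Z C a b = algebraMap ℂ (FunctionField C) c) (n : ℤ) :
    ThresholdRel ν n Color.red a b ↔ ¬ ThresholdRel ν n Color.blue a b := by
  obtain ⟨m, h1, h2⟩ := hν.exists_map_W h
  simp only [ThresholdRel, h1, h2, WithTop.coe_lt_coe, WithTop.coe_le_coe]
  omega

theorem coe_lt_map_intCast_iff {α : ℚ} {x : WithTop ℤ} :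
    (α : WithTop ℚ) < x.map (fun n : ℤ => (n : ℚ)) ↔ ((⌊α⌋ : ℤ) : WithTop ℤ) < x := by
  induction x with
  | top => simp
  | coe x => rw [WithTop.map_coe, WithTop.coe_lt_coe, WithTop.coe_lt_coe, Int.floor_lt]

theorem mem_activeNAC_iff {δ : G.edgeSet → Color} :
    δ ∈ activeNAC G C ↔ IsNAC δ ∧
      ∃ (ν : AddValuation (FunctionField C) (WithTop ℤ)) (n : ℤ), IsTrivialOnConstants C ν ∧
        ∀ (a b : V) (h : G.Adj a b),
          δ ⟨s(a, b), h⟩ = Color.red ↔ ThresholdRel ν n Color.red a b := by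
  simp only [activeNAC, coe_lt_map_intCast_iff, Set.mem_ofPred_eq, ThresholdRel]
  refine and_congr_right fun _ => exists_congr fun ν => ⟨?_, ?_⟩
  · rintro ⟨α, h⟩
    exact ⟨⌊α⌋, h⟩
  · rintro ⟨n, h⟩
    exact ⟨n, by simpa using h⟩

theorem Color.ne_red_iff {c : Color} : c ≠ Color.red ↔ c = Color.blue := by
  cases c <;> simp

theorem IsTrivialOnConstants.color_eq_iff {ν : AddValuation (FunctionField C) (WithTop ℤ)}
    (hν : IsTrivialOnConstants C ν) {n : ℤ} {a b : V}
    (h : ∃ c : ℂ, c ≠ 0 ∧ W C a b * Z C a b = algebraMap ℂ (FunctionField C) c) {d : Color}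
    (hd : d = Color.red ↔ ThresholdRel ν n Color.red a b) (c : Color) :
    d = c ↔ ThresholdRel ν n c a b := by
  cases c
  · exact hd
  · rw [← Color.ne_red_iff, Ne, hd, hν.thresholdRel_iff h, not_not]

theorem exists_thresholdRel_of_unicolor {ν : AddValuation (FunctionField C) (WithTop ℤ)}
    (hν : IsTrivialOnConstants C ν)
    (hG : ∀ a b, G.Adj a b →
      ∃ c : ℂ, c ≠ 0 ∧ W C a b * Z C a b = algebraMap ℂ (FunctionField C) c)
    {u v : V} {P : G.Walk u v} (hP : ∀ δ ∈ activeNAC G C, IsUnicolor δ P) (n : ℤ) :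
    ∃ c, ∀ a b, s(a, b) ∈ P.edges → ThresholdRel ν n c a b := by
  classical
  let δ : G.edgeSet → Color := fun e =>
    if ∃ a b, (e : Sym2 V) = s(a, b) ∧ ThresholdRel ν n Color.red a b then Color.red
    else Color.blue
  have hred : ∀ (a b : V) (h : G.Adj a b),
      δ ⟨s(a, b), h⟩ = Color.red ↔ ThresholdRel ν n Color.red a b := fun a b h => by
    have : δ ⟨s(a, b), h⟩ = Color.red ↔
        ∃ a' b', s(a, b) = s(a', b') ∧ ThresholdRel ν n Color.red a' b' := by
      simp [δ]
    rw [this]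
    constructor
    · rintro ⟨a', b', h1, h2⟩
      rcases Sym2.eq_iff.1 h1 with ⟨rfl, rfl⟩ | ⟨rfl, rfl⟩
      · exact h2
      · exact (equivalence_thresholdRel ν n _).symm h2
    · exact fun h2 => ⟨a, b, rfl, h2⟩
  have hδ : ∀ (a b : V) (h : G.Adj a b) (c : Color),
      δ ⟨s(a, b), h⟩ = c ↔ ThresholdRel ν n c a b := fun a b h =>
    hν.color_eq_iff (hG a b h) (hred a b h)
  have hcolor : ∃ c, ∀ e : G.edgeSet, (e : Sym2 V) ∈ P.edges → δ e = c := by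
    by_cases hsurj : Function.Surjective δ
    · exact hP δ (mem_activeNAC_iff.2
        ⟨isNAC_of_equivalence hsurj _ (equivalence_thresholdRel ν n) hδ, ν, n, hν, hred⟩)
    · rw [Function.Surjective] at hsurj
      push Not at hsurj
      obtain ⟨c, hc⟩ := hsurj
      cases c
      · exact ⟨Color.blue, fun e _ => Color.ne_red_iff.1 (hc e)⟩
      · exact ⟨Color.red, fun e _ => Color.eq_of_ne_of_ne (hc e) (by simp)⟩
  obtain ⟨c, hc⟩ := hcolor
  exact ⟨c, fun a b hab => (hδ a b (P.adj_of_mem_edges hab) c).1 (hc _ hab)⟩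

theorem IsTrivialOnConstants.map_W_mul_Z_nonneg
    {ν : AddValuation (FunctionField C) (WithTop ℤ)} (hν : IsTrivialOnConstants C ν)
    (hG : ∀ a b, G.Adj a b →
      ∃ c : ℂ, c ≠ 0 ∧ W C a b * Z C a b = algebraMap ℂ (FunctionField C) c)
    {u v : V} (huv : u ≠ v) {P : G.Walk u v} (hP : ∀ δ ∈ activeNAC G C, IsUnicolor δ P) :
    0 ≤ ν (W C u v * Z C u v) := by
  obtain ⟨w, hmem⟩ : ∃ w, s(u, w) ∈ P.edges := by
    cases P with
    | nil => exact absurd rfl huv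
    | @cons _ w _ h q => exact ⟨w, by simp⟩
  have hw := hG u w (P.adj_of_mem_edges hmem)
  obtain ⟨m, hW, hZ⟩ := hν.exists_map_W hw
  have key : ∀ n c, ThresholdRel ν n c u w → ThresholdRel ν n c u v := by
    intro n c hc
    obtain ⟨c', hc'⟩ := exists_thresholdRel_of_unicolor hν hG hP n
    have hcc : c' = c := by
      have h1 := hc' u w hmem
      have h2 := hν.thresholdRel_iff hw n
      cases c <;> cases c' <;> simp_all
    subst hcc
    exact rel_of_walk (equivalence_thresholdRel ν n c') P hc'
  have hblue : ((-m : ℤ) : WithTop ℤ) ≤ ν (Z C u v) := key m Color.blue (by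
    simp only [ThresholdRel, hZ, le_refl])
  have hred : ((m - 1 : ℤ) : WithTop ℤ) < ν (W C u v) := key (m - 1) Color.red (by
    simp only [ThresholdRel, hW, WithTop.coe_lt_coe]; omega)
  rw [ν.map_mul]
  generalize ν (W C u v) = x at *
  generalize ν (Z C u v) = y at *
  induction x with
  | top => simp
  | coe x =>
    induction y with
    | top => simp
    | coe y =>
      rw [WithTop.coe_le_coe] at hblue
      rw [WithTop.coe_lt_coe] at hred
      have : 0 ≤ x + y := by omega
      exact_mod_cast this

theorem IsIrreducibleCurve.exists_W_mul_Z_eq [Finite V] (hC : IsIrreducibleCurve C)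
    (hG : ∀ a b, G.Adj a b →
      ∃ c : ℂ, c ≠ 0 ∧ W C a b * Z C a b = algebraMap ℂ (FunctionField C) c)
    {u v : V} (huv : u ≠ v) {P : G.Walk u v} (hP : ∀ δ ∈ activeNAC G C, IsUnicolor δ P) :
    ∃ c : ℂ, W C u v * Z C u v = algebraMap ℂ (FunctionField C) c := by
  have := hC.1.isPrime_complexIdeal
  have : IsDomain (CoordRing C) := inferInstance
  have := essFiniteType_functionField (A := C)
  by_cases hl : IsAlgebraic ℂ (W C u v * Z C u v)
  · have hint := hl.isIntegral
    obtain ⟨c, hc⟩ := minpoly.mem_range_of_degree_eq_one ℂ _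
      (IsAlgClosed.degree_eq_one_of_irreducible ℂ (minpoly.irreducible hint))
    exact ⟨c, hc.symm⟩
  · obtain ⟨ν, hν, hneg⟩ := exists_addValuation_neg hC.2 hl
    exact absurd (IsTrivialOnConstants.map_W_mul_Z_nonneg (ν := ν) hν hG huv hP) (not_le.2 hneg)

end Thresholds

end AlgMotion
end

noncomputable section
namespace AlgMotion

variable {V : Type*} {G : SimpleGraph V} {u v : V} {C : Set (V → Plane)}

open Classical in
/-- The extension of a labeling by the label `d` of the new edge. -/
def extendLabeling (lam : Labeling G) (u v : V) (d : {r : ℝ // 0 < r}) :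
    Labeling (addEdge G u v) :=
  fun e => if h : (e : Sym2 V) ∈ G.edgeSet then lam ⟨e, h⟩ else d

theorem restrictEdges_extendLabeling (lam : Labeling G) (d : {r : ℝ // 0 < r}) :
    restrictEdges (le_addEdge G u v) (extendLabeling lam u v d) = lam := by
  funext ⟨e, he⟩
  exact dif_pos he

theorem norm_sub_eq_of_sym2_eq {a b : V} (h : s(a, b) = s(u, v)) (ρ : V → Plane) :
    ‖ρ a - ρ b‖ = ‖ρ u - ρ v‖ := by
  rcases Sym2.eq_iff.1 h with ⟨rfl, rfl⟩ | ⟨rfl, rfl⟩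
  · rfl
  · exact norm_sub_rev _ _

theorem subset_realizations_extendLabeling {lam : Labeling G}
    (hC : C ⊆ realizations G lam) {d : {r : ℝ // 0 < r}}
    (hd : ∀ ρ ∈ C, ‖ρ u - ρ v‖ = (d : ℝ)) :
    C ⊆ realizations (addEdge G u v) (extendLabeling lam u v d) := by
  intro ρ hρ a b hab
  by_cases h : G.Adj a b
  · rw [hC hρ a b h]
    exact congrArg Subtype.val (congrFun (restrictEdges_extendLabeling lam d) ⟨s(a, b), h⟩).symm
  · obtain ⟨he, -⟩ := (addEdge_adj_iff.1 hab).resolve_left h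
    rw [norm_sub_eq_of_sym2_eq he, hd ρ hρ]
    have hval : extendLabeling lam u v d ⟨s(a, b), hab⟩ = d := dif_neg h
    rw [hval]

theorem labeling_eq_of_subset_realizations {lam₁ lam₂ : Labeling G}
    (hne : C.Nonempty) (h₁ : C ⊆ realizations G lam₁)
    (h₂ : C ⊆ realizations G lam₂) : lam₁ = lam₂ := by
  obtain ⟨ρ, hρ⟩ := hne
  funext ⟨e, he⟩
  induction e with | _ a b
  exact Subtype.ext ((h₁ hρ a b he).symm.trans (h₂ hρ a b he))

theorem exists_pos_dist [Finite V] {lam : Labeling G} (hC : IsIrreducibleCurve C)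
    (hreal : C ⊆ realizations G lam) (hne : ∀ ρ ∈ C, ρ u ≠ ρ v) {P : G.Walk u v}
    (hP : ∀ δ ∈ activeNAC G C, IsUnicolor δ P) :
    ∃ d : {r : ℝ // 0 < r}, ∀ ρ ∈ C, ‖ρ u - ρ v‖ = (d : ℝ) := by
  obtain ⟨ρ₀, hρ₀⟩ := hC.1.2.1
  have huv : u ≠ v := fun h => hne ρ₀ hρ₀ (congrArg ρ₀ h)
  obtain ⟨c, hc⟩ := hC.exists_W_mul_Z_eq (fun a b => W_mul_Z_of_adj hreal) huv hP
  rw [W_mul_Z_eq_iff] at hc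
  refine ⟨⟨‖ρ₀ u - ρ₀ v‖, norm_pos_iff.2 (sub_ne_zero.2 (hne ρ₀ hρ₀))⟩, fun ρ hρ => ?_⟩
  have h := (hc ρ hρ).trans (hc ρ₀ hρ₀).symm
  exact (sq_eq_sq₀ (norm_nonneg _) (norm_nonneg _)).1 (Complex.ofReal_injective h)

theorem activeNAC_addEdge {lam' : Labeling (addEdge G u v)}
    (hreal : C ⊆ realizations (addEdge G u v) lam') (huv : u ≠ v) (hadj : ¬ G.Adj u v)
    {P : G.Walk u v} (hpath : P.IsPath) (hP : ∀ δ ∈ activeNAC G C, IsUnicolor δ P) :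
    activeNAC (addEdge G u v) C =
      {δ' | IsNAC δ' ∧ restrictEdges (le_addEdge G u v) δ' ∈ activeNAC G C} := by
  ext δ'
  rw [Set.mem_ofPred_eq]
  constructor
  · intro h
    obtain ⟨hδ', ν, n, hν, hred⟩ := mem_activeNAC_iff.1 h
    exact ⟨hδ', mem_activeNAC_iff.2 ⟨hδ'.restrictEdges huv hadj hpath, ν, n, hν,
      fun a b hab => hred a b (le_addEdge G u v hab)⟩⟩
  · rintro ⟨hδ', hact⟩
    obtain ⟨c, hc⟩ := hP _ hact
    obtain ⟨-, ν, n, hν, hred⟩ := mem_activeNAC_iff.1 hact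
    have huvc := hδ'.color_addEdge_eq huv hadj hpath hc
    have hprod : ∀ a b, (addEdge G u v).Adj a b → _ := fun a b => W_mul_Z_of_adj hreal
    have hrel : ThresholdRel ν n c u v :=
      rel_of_walk (equivalence_thresholdRel ν n c) P fun a b hab => by
        have hadj' := P.adj_of_mem_edges hab
        exact (hν.color_eq_iff (hprod a b (le_addEdge G u v hadj')) (hred a b hadj') c).1
          (hc ⟨s(a, b), hadj'⟩ hab)
    have huvred : c = Color.red ↔ ThresholdRel ν n Color.red u v := by
      have := hν.thresholdRel_iff (hprod u v (addEdge_adj huv)) n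
      cases c <;> simp_all
    refine mem_activeNAC_iff.2 ⟨hδ', ν, n, hν, fun a b hab => ?_⟩
    by_cases h : G.Adj a b
    · exact hred a b h
    · obtain ⟨he, -⟩ := (addEdge_adj_iff.1 hab).resolve_left h
      have hcol : δ' ⟨s(a, b), hab⟩ = c := (congrArg δ' (Subtype.ext he)).trans huvc
      rw [hcol, huvred]
      rcases Sym2.eq_iff.1 he with ⟨rfl, rfl⟩ | ⟨rfl, rfl⟩
      · rfl
      · exact ⟨(equivalence_thresholdRel ν n _).symm, (equivalence_thresholdRel ν n _).symm⟩

end AlgMotion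
end

theorem mainTheorem7 {V : Type*} [Finite V] (G : SimpleGraph V) (hG : G.Connected)
    (lam : AlgMotion.Labeling G) (C : Set (V → AlgMotion.Plane))
    (hC : AlgMotion.IsAlgebraicMotion G lam C)
    (u v : V) (huv : ¬ G.Adj u v) (hne : ∀ ρ ∈ C, ρ u ≠ ρ v)
    (hP : ∃ P : G.Walk u v, P.IsPath ∧ ∀ δ ∈ AlgMotion.activeNAC G C, AlgMotion.IsUnicolor δ P) :
    (∃! lam' : AlgMotion.Labeling (AlgMotion.addEdge G u v),
        AlgMotion.restrictEdges (AlgMotion.le_addEdge G u v) lam' = lam ∧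
          AlgMotion.IsAlgebraicMotion (AlgMotion.addEdge G u v) lam' C) ∧
      AlgMotion.activeNAC (AlgMotion.addEdge G u v) C =
        {δ' | AlgMotion.IsNAC δ' ∧
          AlgMotion.restrictEdges (AlgMotion.le_addEdge G u v) δ' ∈ AlgMotion.activeNAC G C} := by
  obtain ⟨a, b, hab, -, hcurve, hreal, hfix⟩ := hC
  obtain ⟨P, hpath, hP⟩ := hP
  obtain ⟨ρ₀, hρ₀⟩ := hcurve.1.2.1
  have hne' : u ≠ v := fun h => hne ρ₀ hρ₀ (congrArg ρ₀ h)
  obtain ⟨d, hd⟩ := AlgMotion.exists_pos_dist hcurve hreal hne hP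
  have hreal' := AlgMotion.subset_realizations_extendLabeling hreal hd
  have hres := AlgMotion.restrictEdges_extendLabeling (u := u) (v := v) lam d
  have hlab : AlgMotion.extendLabeling lam u v d ⟨s(a, b), AlgMotion.le_addEdge G u v hab⟩ =
      lam ⟨s(a, b), hab⟩ := congrFun hres ⟨s(a, b), hab⟩
  refine ⟨⟨AlgMotion.extendLabeling lam u v d, ⟨hres, a, b, AlgMotion.le_addEdge G u v hab,
    AlgMotion.isFlexible_of_infinite hcurve.infinite hreal' (lam ⟨s(a, b), hab⟩).2.ne' hfix,
    hcurve, hreal', by simpa only [hlab] using hfix⟩, ?_⟩,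
    AlgMotion.activeNAC_addEdge hreal' hne' huv hpath hP⟩
  rintro lam' ⟨-, _, _, _, -, -, hreal'', -⟩
  exact AlgMotion.labeling_eq_of_subset_realizations ⟨ρ₀, hρ₀⟩ hreal'' hreal'
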